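/- For an odd prime power $q$ such that $3$ is a square in $\mathbb F_q$, and $t\in\mathbb F_q^*$, write $\|x\|=x_1^2+x_2^2$ for $x\in\mathbb F_q^2$, let $S_t=\{x\in\mathbb F_q^2:\|x\|=t\}$, identified with its indicator function, and for $f_1,f_2,f_3:\mathbb F_q^2\to[0,\infty)$ let $$\Delta(f_1,f_2,f_3)=\frac{1}{q^2|S_t|}\sum_{x^1,x^2,x^3\in\mathbb F_q^2}S_t(x^1-x^2)\,S_t(x^2-x^3)\,S_t(x^3-x^1)\,f_1(x^1)f_2(x^2)f_3(x^3).$$ Let $\|f\|_p=\bigl(q^{-2}\sum_{x}|f(x)|^p\bigr)^{1/p}$ for $1\le p<\infty$ and $\|f\|_\infty=\max_x|f(x)|$. For $1\le p_1,p_2,p_3\le\infty$ let $\Delta(p_1,p_2,p_3)$ (which depends on $q$ and $t$) be the best constant $C$ in $$\Delta(f_1,f_2,f_3)\le C\,\|f_1\|_{p_1}\|f_2\|_{p_2}\|f_3\|_{p_3}\qquad\text{for all non-negative } f_1,f_2,f_3 .$$ For a family $\mathcal Q$ of pairs $(\mathbb F_q,t)$ as above, say that $\Delta(p_1,p_2,p_3)\lesssim1$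 along $\mathcal Q$ if there is a constant $C\ge1$, independent of $q$ and $t$, with $\Delta(p_1,p_2,p_3)\le C$ for all members of $\mathcal Q$. **Theorem.** Let $1\le p_1,p_2,p_3\le\infty$, with the convention $1/\infty=0$. (i) Let $\mathcal Q$ be any family of such pairs in which $q$ is unbounded (for example, all such pairs). If $\Delta(p_1,p_2,p_3)\lesssim1$ along $\mathcal Q$, then $$\frac2{p_1}+\frac1{p_2}+\frac1{p_3}\le2,\qquad \frac1{p_1}+\frac2{p_2}+\frac1{p_3}\le2,\qquad \frac1{p_1}+\frac1{p_2}+\frac2{p_3}\le2.$$ (ii) Conversely, if all three inequalities hold and $(p_1,p_2,p_3)\ne(2,2,2)$, then $\Delta(p_1,p_2,p_3)\lesssim1$ along the family of all such pairs. At $(2,2,2)$ the restricted strong-type estimate holds: there is a constant $C\ge1$ such that for all such $q$ and $t$ and all subsets $E_1,E_2,E_3\subseteq\mathbb F_q^2$, $$\Delta(1_{E_1},1_{E_2},1_{E_3})\le C\,\|1_{E_1}\|_2\,\|1_{E_2}\|_2\,\|1_{E_3}\|_2 .$$ -/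

import Mathlib

open scoped ENNReal

noncomputable section

namespace KThree

/-- The plane `F_q^2` over a field `F = F_q`. -/
abbrev Plane (F : Type) : Type := Fin 2 → F

/-- The circle `S_t = {x : x_1^2 + x_2^2 = t}` in `F_q^2`. -/
def circle {F : Type} [Field F] (t : F) : Set (Plane F) := {x | x 0 ^ 2 + x 1 ^ 2 = t}

/-- The indicator function of a subset of `F_q^2`. -/
def ind {F : Type} (E : Set (Plane F)) : Plane F → ℝ := E.indicator (fun _ => 1)

/-- The norm `‖f‖_p` on `F_q^2` with respect to the normalized counting measure
(the maximum of `|f|` when `p = ∞`). -/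
def lpNorm {F : Type} [Fintype F] (p : ℝ≥0∞) (f : Plane F → ℝ) : ℝ :=
  if p = ∞ then ⨆ x, |f x|
  else (((Fintype.card F : ℝ) ^ 2)⁻¹ * ∑ x, |f x| ^ p.toReal) ^ (1 / p.toReal)

/-- The trilinear form of the graph `K_3` on `F_q^2`, normalized by `q^2 |S_t|`. -/
def form {F : Type} [Field F] [Fintype F] (t : F) (f₁ f₂ f₃ : Plane F → ℝ) : ℝ :=
  1 / ((Fintype.card F : ℝ) ^ 2 * ((circle t).ncard : ℝ)) *
    ∑ x₁, ∑ x₂, ∑ x₃,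
      ind (circle t) (x₁ - x₂) * ind (circle t) (x₂ - x₃) * ind (circle t) (x₃ - x₁) *
        (f₁ x₁ * f₂ x₂ * f₃ x₃)

/-- `Δ(p₁, p₂, p₃)`: the best constant in
`Δ(f₁, f₂, f₃) ≤ C ‖f₁‖_{p₁} ‖f₂‖_{p₂} ‖f₃‖_{p₃}` over non-negative functions. -/
def bestConst {F : Type} [Field F] [Fintype F] (t : F) (p₁ p₂ p₃ : ℝ≥0∞) : ℝ :=
  sInf {C : ℝ | 0 < C ∧ ∀ f₁ f₂ f₃ : Plane F → ℝ,
    (∀ x, 0 ≤ f₁ x) → (∀ x, 0 ≤ f₂ x) → (∀ x, 0 ≤ f₃ x) →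
      form t f₁ f₂ f₃ ≤ C * (lpNorm p₁ f₁ * lpNorm p₂ f₂ * lpNorm p₃ f₃)}

/-- An admissible pair `(F_q, t)`: a finite field of odd order in which `3` is a square, and a
non-zero radius `t`. -/
structure Datum where
  /-- the field `F_q` -/
  F : Type
  [field : Field F]
  [fintype : Fintype F]
  /-- the radius -/
  t : F
  t_ne_zero : t ≠ 0
  two_ne_zero : (2 : F) ≠ 0
  isSquare_three : IsSquare (3 : F)

attribute [instance] Datum.field Datum.fintype

/-- `q`, the order of the field. -/
def Datum.q (D : Datum) : ℕ := Fintype.card D.F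

/-- The family contains pairs `(F_q, t)` with `q` arbitrarily large. -/
def Unbounded (𝒬 : Set Datum) : Prop := ∀ N : ℕ, ∃ D ∈ 𝒬, N ≤ D.q

/-- `Δ(p₁, p₂, p₃) ≲ 1` along the family `𝒬`: the constant depends neither on `q` nor on `t`. -/
def LesssimOne (𝒬 : Set Datum) (p₁ p₂ p₃ : ℝ≥0∞) : Prop :=
  ∃ C : ℝ, 1 ≤ C ∧ ∀ D ∈ 𝒬, bestConst D.t p₁ p₂ p₃ ≤ C

/-- The restricted strong-type `Δ(p₁, p₂, p₃)` estimate along the family `𝒬`: the estimate for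
indicator functions of arbitrary sets, with a constant independent of `q` and `t`. -/
def RestrictedStrongType (𝒬 : Set Datum) (p₁ p₂ p₃ : ℝ≥0∞) : Prop :=
  ∃ C : ℝ, 1 ≤ C ∧ ∀ D ∈ 𝒬, ∀ E₁ E₂ E₃ : Set (Plane D.F),
    form D.t (ind E₁) (ind E₂) (ind E₃) ≤
      C * (lpNorm p₁ (ind E₁) * lpNorm p₂ (ind E₂) * lpNorm p₃ (ind E₃))

/-- The three inequalities on the exponents (`1 / ∞ = 0`). -/
def ExponentCondition (p₁ p₂ p₃ : ℝ≥0∞) : Prop :=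
  2 / p₁ + 1 / p₂ + 1 / p₃ ≤ 2 ∧ 1 / p₁ + 2 / p₂ + 1 / p₃ ≤ 2 ∧ 1 / p₁ + 1 / p₂ + 2 / p₃ ≤ 2

lemma lpNorm_nonneg {F : Type} [Fintype F] (p : ℝ≥0∞) (f : Plane F → ℝ) : 0 ≤ lpNorm p f := by
  unfold lpNorm
  split_ifs
  · exact Real.iSup_nonneg fun x => abs_nonneg _
  · positivity

lemma exists_le_lpNorm {F : Type} [Field F] [Fintype F] (p : ℝ≥0∞) (hp : 1 ≤ p) :
    ∃ M : ℝ, 0 < M ∧ ∀ (f : Plane F → ℝ) (x : Plane F), |f x| ≤ M * lpNorm p f := by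
  by_cases h : p = ∞
  · refine ⟨1, one_pos, fun f x => ?_⟩
    simp only [lpNorm, h, if_true, one_mul]
    exact le_ciSup (f := fun x => |f x|) (Set.finite_range _).bddAbove x
  · have hpos : 0 < p.toReal := ENNReal.toReal_pos (by positivity) h
    have hq : (0 : ℝ) < (Fintype.card F : ℝ) ^ 2 := by
      have : 0 < Fintype.card F := Fintype.card_pos
      positivity
    refine ⟨((Fintype.card F : ℝ) ^ 2) ^ (1 / p.toReal), by positivity, fun f x => ?_⟩
    simp only [lpNorm, h, if_false]
    have hs : 0 ≤ ∑ x, |f x| ^ p.toReal := by positivity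
    rw [← Real.mul_rpow hq.le (by positivity), mul_inv_cancel_left₀ hq.ne']
    have h1 : |f x| ^ p.toReal ≤ ∑ x, |f x| ^ p.toReal :=
      Finset.single_le_sum (f := fun x => |f x| ^ p.toReal) (fun i _ => by positivity)
        (Finset.mem_univ x)
    calc |f x| = (|f x| ^ p.toReal) ^ (1 / p.toReal) := by
          rw [one_div, Real.rpow_rpow_inv (abs_nonneg _) hpos.ne']
      _ ≤ _ := Real.rpow_le_rpow (by positivity) h1 (by positivity)

lemma ind_nonneg {F : Type} (E : Set (Plane F)) (x : Plane F) : 0 ≤ ind E x :=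
  Set.indicator_nonneg (fun _ _ => zero_le_one) x

/-- The set that defines the best constant is non-empty. -/
lemma exists_bound {F : Type} [Field F] [Fintype F] (t : F) (p₁ p₂ p₃ : ℝ≥0∞)
    (h₁ : 1 ≤ p₁) (h₂ : 1 ≤ p₂) (h₃ : 1 ≤ p₃) :
    ∃ C : ℝ, 0 < C ∧ ∀ f₁ f₂ f₃ : Plane F → ℝ,
      (∀ x, 0 ≤ f₁ x) → (∀ x, 0 ≤ f₂ x) → (∀ x, 0 ≤ f₃ x) →
        form t f₁ f₂ f₃ ≤ C * (lpNorm p₁ f₁ * lpNorm p₂ f₂ * lpNorm p₃ f₃) := by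
  obtain ⟨M₁, hM₁, H₁⟩ := exists_le_lpNorm (F := F) p₁ h₁
  obtain ⟨M₂, hM₂, H₂⟩ := exists_le_lpNorm (F := F) p₂ h₂
  obtain ⟨M₃, hM₃, H₃⟩ := exists_le_lpNorm (F := F) p₃ h₃
  set c : ℝ := 1 / ((Fintype.card F : ℝ) ^ 2 * ((circle t).ncard : ℝ)) with hc
  have hc0 : 0 ≤ c := by positivity
  set S : ℝ := ∑ x₁ : Plane F, ∑ x₂ : Plane F, ∑ x₃ : Plane F,
    ind (circle t) (x₁ - x₂) * ind (circle t) (x₂ - x₃) * ind (circle t) (x₃ - x₁) with hS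
  have hS0 : 0 ≤ S := Finset.sum_nonneg fun i _ => Finset.sum_nonneg fun j _ =>
    Finset.sum_nonneg fun k _ => mul_nonneg (mul_nonneg (ind_nonneg _ _) (ind_nonneg _ _))
      (ind_nonneg _ _)
  refine ⟨c * S * (M₁ * M₂ * M₃) + 1, by positivity, fun f₁ f₂ f₃ n₁ n₂ n₃ => ?_⟩
  have N₁ := lpNorm_nonneg p₁ f₁
  have N₂ := lpNorm_nonneg p₂ f₂
  have N₃ := lpNorm_nonneg p₃ f₃
  have key : form t f₁ f₂ f₃ ≤
      c * (S * ((M₁ * lpNorm p₁ f₁) * (M₂ * lpNorm p₂ f₂) * (M₃ * lpNorm p₃ f₃))) := by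
    unfold form
    refine mul_le_mul_of_nonneg_left ?_ hc0
    rw [hS]
    simp only [Finset.sum_mul]
    refine Finset.sum_le_sum fun i _ => Finset.sum_le_sum fun j _ => Finset.sum_le_sum fun k _ => ?_
    refine mul_le_mul_of_nonneg_left ?_ (mul_nonneg (mul_nonneg (ind_nonneg _ _) (ind_nonneg _ _))
      (ind_nonneg _ _))
    have a₁ := (le_abs_self _).trans (H₁ f₁ i)
    have a₂ := (le_abs_self _).trans (H₂ f₂ j)
    have a₃ := (le_abs_self _).trans (H₃ f₃ k)
    have m₁ := n₁ i
    have m₂ := n₂ j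
    have m₃ := n₃ k
    gcongr
  have : 0 ≤ lpNorm p₁ f₁ * lpNorm p₂ f₂ * lpNorm p₃ f₃ := by positivity
  nlinarith [key]

/-- The best constant is attained: it is itself an admissible constant. -/
lemma form_le_bestConst {F : Type} [Field F] [Fintype F] (t : F) (p₁ p₂ p₃ : ℝ≥0∞)
    (h₁ : 1 ≤ p₁) (h₂ : 1 ≤ p₂) (h₃ : 1 ≤ p₃) (f₁ f₂ f₃ : Plane F → ℝ)
    (n₁ : ∀ x, 0 ≤ f₁ x) (n₂ : ∀ x, 0 ≤ f₂ x) (n₃ : ∀ x, 0 ≤ f₃ x) :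
    form t f₁ f₂ f₃ ≤ bestConst t p₁ p₂ p₃ *
      (lpNorm p₁ f₁ * lpNorm p₂ f₂ * lpNorm p₃ f₃) := by
  obtain ⟨C, hC⟩ := exists_bound t p₁ p₂ p₃ h₁ h₂ h₃
  have hP : 0 ≤ lpNorm p₁ f₁ * lpNorm p₂ f₂ * lpNorm p₃ f₃ :=
    mul_nonneg (mul_nonneg (lpNorm_nonneg _ _) (lpNorm_nonneg _ _)) (lpNorm_nonneg _ _)
  rcases hP.eq_or_lt with h | h
  · have := hC.2 f₁ f₂ f₃ n₁ n₂ n₃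
    rw [← h] at this ⊢
    simpa using this
  · rw [← div_le_iff₀ h]
    refine le_csInf ⟨C, hC⟩ fun D hD => ?_
    rw [div_le_iff₀ h]
    exact hD.2 f₁ f₂ f₃ n₁ n₂ n₃

/-- The family of all admissible pairs contains arbitrarily large fields. -/
lemma unbounded_univ : Unbounded Set.univ := by
  intro N
  have : Fact (Nat.Prime 11) := ⟨by norm_num⟩
  have hN : N + 1 ≠ 0 := by omega
  have : Fintype (GaloisField 11 (N + 1)) := Fintype.ofFinite _
  have h2 : (2 : GaloisField 11 (N + 1)) ≠ 0 := by
    intro h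
    have h' : ((2 : ℕ) : GaloisField 11 (N + 1)) = 0 := by exact_mod_cast h
    rw [CharP.cast_eq_zero_iff (GaloisField 11 (N + 1)) 11] at h'
    omega
  have h3 : IsSquare (3 : GaloisField 11 (N + 1)) := by
    refine ⟨5, ?_⟩
    have h' : ((22 : ℕ) : GaloisField 11 (N + 1)) = 0 := by
      rw [CharP.cast_eq_zero_iff (GaloisField 11 (N + 1)) 11]; norm_num
    have : (5 : GaloisField 11 (N + 1)) * 5 = 3 + ((22 : ℕ) : GaloisField 11 (N + 1)) := by
      norm_num
    rw [this, h', add_zero]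
  refine ⟨⟨GaloisField 11 (N + 1), 1, one_ne_zero, h2, h3⟩, trivial, ?_⟩
  show N ≤ Fintype.card (GaloisField 11 (N + 1))
  rw [← Nat.card_eq_fintype_card, GaloisField.card 11 (N + 1) hN]
  exact (Nat.le_succ N).trans (Nat.lt_pow_self (by norm_num)).le

end KThree

end

/-
Join two points of `F_q^2` when their difference lies on `S_t`. Two distinct points then have at
most two common neighbours, so `Δ` sums over the triangles of a graph of degree at most `2 q` and
codegree at most `2`. Write `f_i ≤ ‖f_i‖_{p_i} g_i ^ (1 / p_i)` with `g_i ≥ 0` of mean at most one.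
Weighted AM–GM bounds the product of these powers pointwise by a convex combination of the products
for the exponents `(2, 2, 2)`, `(3/2, 3/2, ∞)`, `(1, ∞, ∞)` and `(∞, ∞, ∞)`, up to the order of the
indices. Those four sums over triangles are controlled by Cauchy–Schwarz, Hölder and the codegree
bound alone, which also gives the strong type at `(2, 2, 2)`.

The conditions on the exponents are necessary because, when `3` is a square, the rotation by `60°`
is defined over `F_q`: every point of `S_t` lies in a triangle with the origin and another point of
`S_t`, and the indicators of the origin and of `S_t` violate the estimate for large `q` otherwise.
-/

namespace KThree

section Sums

open Finset

lemma sum_sq_mul_pow_three_le {ι : Type*} (s : Finset ι) {u v : ι → ℝ} (hu : ∀ i, 0 ≤ u i)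
    (hv : ∀ i, 0 ≤ v i) :
    (∑ i ∈ s, u i ^ 2 * v i) ^ 3 ≤ (∑ i ∈ s, u i ^ 3) ^ 2 * ∑ i ∈ s, v i ^ 3 := by
  have holder := Real.inner_le_Lp_mul_Lq_of_nonneg s (p := 3 / 2) (q := 3)
    (by constructor <;> norm_num) (f := fun i => u i ^ 2) (g := v)
    (fun i _ => by positivity) (fun i _ => hv i)
  have u_rpow : ∀ i, (u i ^ 2) ^ (3 / 2 : ℝ) = u i ^ 3 := fun i => by
    rw [← Real.rpow_natCast, ← Real.rpow_mul (hu i), ← Real.rpow_natCast]; norm_num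
  have v_rpow : ∀ i, v i ^ (3 : ℝ) = v i ^ 3 := fun i => by
    rw [← Real.rpow_natCast]; norm_num
  simp only [u_rpow, v_rpow] at holder
  have hU : 0 ≤ ∑ i ∈ s, u i ^ 3 := sum_nonneg fun i _ => pow_nonneg (hu i) 3
  have hV : 0 ≤ ∑ i ∈ s, v i ^ 3 := sum_nonneg fun i _ => pow_nonneg (hv i) 3
  have hUV : 0 ≤ ∑ i ∈ s, u i ^ 2 * v i :=
    sum_nonneg fun i _ => mul_nonneg (sq_nonneg _) (hv i)
  refine (pow_le_pow_left₀ hUV holder 3).trans_eq ?_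
  rw [mul_pow, ← Real.rpow_natCast, ← Real.rpow_natCast (_ ^ _), ← Real.rpow_mul hU,
    ← Real.rpow_mul hV, ← Real.rpow_natCast]
  norm_num

variable {α : Type*}

lemma sum_offDiag {M : Type*} [AddCommMonoid M] [DecidableEq α] (s : Finset α) (φ : α × α → M) :
    ∑ p ∈ s.offDiag, φ p = ∑ a ∈ s, ∑ c ∈ s.erase a, φ (a, c) := by
  rw [sum_sigma']
  refine sum_nbij' (fun p => ⟨p.1, p.2⟩) (fun x => (x.1, x.2)) ?_ ?_ (fun _ _ => rfl)
    (fun _ _ => rfl) (fun _ _ => rfl) <;>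
  · intro x hx
    simp only [mem_offDiag, mem_sigma, mem_erase] at hx ⊢
    tauto

lemma sq_sum_eq_sum_sq_add_sum_offDiag (s : Finset α) (w : α → ℝ) :
    (∑ a ∈ s, w a) ^ 2 = ∑ a ∈ s, w a ^ 2 + ∑ p ∈ s.offDiag, w p.1 * w p.2 := by
  classical
  simp_rw [sum_offDiag, sq, sum_mul_sum, ← sum_add_distrib]
  exact sum_congr rfl fun a ha => (add_sum_erase s _ ha).symm

lemma sum_erase_mul_sum_le_sum_offDiag [DecidableEq α] {s : Finset α} {φ ψ : α → ℝ} {m : α}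
    (hm : m ∈ s) (hφ : ∀ a ∈ s, φ a ≤ φ m) (hψ : ∀ c, 0 ≤ ψ c) :
    (∑ a ∈ s.erase m, φ a) * ∑ c ∈ s, ψ c ≤ ∑ p ∈ s.offDiag, φ p.1 * ψ p.2 := by
  calc (∑ a ∈ s.erase m, φ a) * ∑ c ∈ s, ψ c
      ≤ ∑ a ∈ s.erase m, (φ m * ψ a + φ a * ∑ c ∈ s.erase a, ψ c) := by
        rw [sum_mul]
        refine sum_le_sum fun a ha => ?_
        have ha := mem_of_mem_erase ha
        rw [← add_sum_erase s ψ ha, mul_add]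
        exact add_le_add_left (mul_le_mul_of_nonneg_right (hφ a ha) (hψ a)) _
    _ = ∑ a ∈ s, φ a * ∑ c ∈ s.erase a, ψ c := by
        rw [sum_add_distrib, ← mul_sum,
          add_sum_erase s (fun a => φ a * ∑ c ∈ s.erase a, ψ c) hm]
    _ = ∑ p ∈ s.offDiag, φ p.1 * ψ p.2 := by simp only [sum_offDiag, mul_sum]

end Sums

section Graph

open Finset SimpleGraph

variable {V : Type*} [Fintype V] {G : SimpleGraph V} [DecidableRel G.Adj]

/-- The ordered triangles of a graph. -/
def triangles (G : SimpleGraph V) [DecidableRel G.Adj] : Finset (V × V × V) :=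
  {x | G.Adj x.1 x.2.1 ∧ G.Adj x.2.1 x.2.2 ∧ G.Adj x.2.2 x.1}

/-- The trilinear form of a graph that counts its ordered triangles with weights. -/
def triangleSum (G : SimpleGraph V) [DecidableRel G.Adj] (f₁ f₂ f₃ : V → ℝ) : ℝ :=
  ∑ x ∈ triangles G, f₁ x.1 * f₂ x.2.1 * f₃ x.2.2

lemma mem_triangles {x : V × V × V} :
    x ∈ triangles G ↔ G.Adj x.1 x.2.1 ∧ G.Adj x.2.1 x.2.2 ∧ G.Adj x.2.2 x.1 := by
  simp [triangles]

lemma triangleSum_swap (f₁ f₂ f₃ : V → ℝ) :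
    triangleSum G f₂ f₁ f₃ = triangleSum G f₁ f₂ f₃ := by
  refine sum_nbij' (fun x => (x.2.1, x.1, x.2.2)) (fun x => (x.2.1, x.1, x.2.2))
    ?_ ?_ (fun _ _ => rfl) (fun _ _ => rfl) (fun x _ => by ring) <;>
  · simp only [mem_triangles]
    exact fun x hx => ⟨hx.1.symm, hx.2.2.symm, hx.2.1.symm⟩

lemma triangleSum_rotate (f₁ f₂ f₃ : V → ℝ) :
    triangleSum G f₂ f₃ f₁ = triangleSum G f₁ f₂ f₃ := by
  refine sum_nbij' (fun x => (x.2.2, x.1, x.2.1)) (fun x => (x.2.1, x.2.2, x.1))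
    ?_ ?_ (fun _ _ => rfl) (fun _ _ => rfl) (fun x _ => by ring) <;>
  · simp only [mem_triangles]
    tauto

lemma sum_sum_neighborFinset_le {d : ℕ} (hd : ∀ a, G.degree a ≤ d) {f : V → ℝ}
    (hf : ∀ a, 0 ≤ f a) : ∑ b, ∑ a ∈ G.neighborFinset b, f a ≤ d * ∑ a, f a := by
  have comm : ∑ b, ∑ a ∈ G.neighborFinset b, f a = ∑ a, ∑ _b ∈ G.neighborFinset a, f a :=
    sum_comm' fun b a => by simp [G.adj_comm]
  rw [comm, mul_sum]
  refine sum_le_sum fun a _ => ?_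
  rw [sum_const, nsmul_eq_mul, card_neighborFinset_eq_degree]
  exact mul_le_mul_of_nonneg_right (by exact_mod_cast hd a) (hf a)

lemma sum_edges_pow_three_le {d : ℕ} (hd : ∀ a, G.degree a ≤ d)
    {u v : V → ℝ} (hu : ∀ a, 0 ≤ u a) (hv : ∀ a, 0 ≤ v a) :
    (∑ b, ∑ a ∈ G.neighborFinset b, (u a ^ 2) ^ 2 * v b) ^ 3 ≤
      (d * ∑ a, u a ^ 3) ^ 2 * ((∑ a, u a ^ 3) ^ 2 * ∑ a, v a ^ 3) := by
  have hu3 : ∀ a, 0 ≤ u a ^ 3 := fun a => pow_nonneg (hu a) 3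
  have weight_left : ∑ b, ∑ a ∈ G.neighborFinset b, u a ^ 3 ≤ d * ∑ a, u a ^ 3 :=
    sum_sum_neighborFinset_le hd hu3
  have weight_right : ∑ b, ∑ a ∈ G.neighborFinset b, (u a ^ 2 * v b) ^ 3 ≤
      (∑ a, u a ^ 3) ^ 2 * ∑ a, v a ^ 3 := by
    rw [mul_sum]
    refine sum_le_sum fun b _ => ?_
    simp_rw [mul_pow, ← sum_mul, ← pow_mul, mul_comm 2 3, pow_mul]
    refine mul_le_mul_of_nonneg_right ?_ (pow_nonneg (hv b) 3)
    exact (sum_le_univ_sum_of_nonneg fun a => sq_nonneg _).trans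
      (sum_sq_le_sq_sum_of_nonneg fun a _ => hu3 a)
  rw [sum_sigma'] at *
  have h := sum_sq_mul_pow_three_le
    (univ.sigma fun b => G.neighborFinset b) (u := fun x => u x.2)
    (v := fun x => u x.2 ^ 2 * v x.1) (fun x => hu _) fun x => mul_nonneg (sq_nonneg _) (hv _)
  refine le_trans (le_of_eq ?_) <| h.trans (mul_le_mul (pow_le_pow_left₀ (sum_nonneg fun x _ =>
    hu3 _) weight_left 2) weight_right
    (sum_nonneg fun x _ => pow_nonneg (mul_nonneg (sq_nonneg _) (hv _)) 3) (sq_nonneg _))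
  congr 1
  exact sum_congr rfl fun x _ => by ring

/-- A weight on the vertices that is non-negative and has mean at most one. -/
def IsSubdensity (g : V → ℝ) : Prop :=
  (∀ a, 0 ≤ g a) ∧ ∑ a, g a ≤ Fintype.card V

lemma IsSubdensity.sum_le {g : V → ℝ} (hg : IsSubdensity g) {d : ℕ}
    (hV : Fintype.card V ≤ d ^ 2) : ∑ a, g a ≤ (d : ℝ) ^ 2 :=
  hg.2.trans (by exact_mod_cast hV)

variable [DecidableEq V]

/-- The bound `k` on the codegrees of a graph: two distinct vertices have at most `k` common
neighbours. -/
def CodegreeLE (G : SimpleGraph V) [DecidableRel G.Adj] (k : ℕ) : Prop :=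
  ∀ ⦃a b⦄, a ≠ b → #(G.neighborFinset a ∩ G.neighborFinset b) ≤ k

lemma sum_triangles_eq {M : Type*} [AddCommMonoid M] (φ : V → V → V → M) :
    ∑ x ∈ triangles G, φ x.1 x.2.1 x.2.2 =
      ∑ b, ∑ a ∈ G.neighborFinset b, ∑ c ∈ G.neighborFinset b ∩ G.neighborFinset a,
        φ a b c := by
  rw [sum_sigma', sum_sigma']
  refine sum_nbij' (fun x => ⟨⟨x.2.1, x.1⟩, x.2.2⟩) (fun y => (y.1.2, y.1.1, y.2))
    ?_ ?_ (fun _ _ => rfl) (fun _ _ => rfl) (fun _ _ => rfl) <;>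
  · intro x hx
    simp only [mem_triangles, mem_sigma, mem_univ, true_and, mem_inter,
      mem_neighborFinset] at hx ⊢
    grind [G.adj_comm]

lemma sum_triangles_edge_le {k : ℕ} (hG : CodegreeLE G k) {φ : V → V → ℝ}
    (hφ : ∀ a b, 0 ≤ φ a b) :
    ∑ x ∈ triangles G, φ x.1 x.2.1 ≤ k * ∑ b, ∑ a ∈ G.neighborFinset b, φ a b := by
  rw [sum_triangles_eq fun a b _ => φ a b, mul_sum]
  refine sum_le_sum fun b _ => ?_
  rw [mul_sum]
  refine sum_le_sum fun a ha => ?_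
  rw [sum_const, nsmul_eq_mul]
  exact mul_le_mul_of_nonneg_right (by exact_mod_cast hG (G.ne_of_adj (by simpa using ha)))
    (hφ a b)

lemma sum_triangles_vertex_le {k d : ℕ} (hG : CodegreeLE G k) (hd : ∀ a, G.degree a ≤ d)
    {f : V → ℝ} (hf : ∀ a, 0 ≤ f a) :
    ∑ x ∈ triangles G, f x.1 ≤ k * (d * ∑ a, f a) :=
  (sum_triangles_edge_le hG fun a _ => hf a).trans <|
    mul_le_mul_of_nonneg_left (sum_sum_neighborFinset_le hd hf) k.cast_nonneg

lemma sum_offDiag_neighborFinset_le {k : ℕ} (hG : CodegreeLE G k) {φ : V × V → ℝ}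
    (hφ : ∀ p, 0 ≤ φ p) :
    ∑ b, ∑ p ∈ (G.neighborFinset b).offDiag, φ p ≤ k * ∑ p, φ p := by
  have comm : ∑ b, ∑ p ∈ (G.neighborFinset b).offDiag, φ p =
      ∑ p ∈ univ.offDiag, ∑ _b ∈ G.neighborFinset p.1 ∩ G.neighborFinset p.2, φ p :=
    sum_comm' fun b p => by simp [G.adj_comm b]; tauto
  rw [comm, mul_sum]
  refine (sum_le_sum fun p hp => ?_).trans (sum_le_univ_sum_of_nonneg fun p => ?_)
  · rw [sum_const, nsmul_eq_mul]
    exact mul_le_mul_of_nonneg_right (by exact_mod_cast hG (by simpa using hp)) (hφ p)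
  · exact mul_nonneg k.cast_nonneg (hφ p)

lemma sum_paths_pow_three_le {k d : ℕ} (hG : CodegreeLE G k) (hd : ∀ a, G.degree a ≤ d)
    {u v : V → ℝ} (hu : ∀ a, 0 ≤ u a) (hv : ∀ a, 0 ≤ v a) :
    (∑ b, ∑ p ∈ (G.neighborFinset b).offDiag, (u p.1 * u p.2) ^ 2 * v b) ^ 3 ≤
      (k * (∑ a, u a ^ 3) ^ 2) ^ 2 * (d ^ 2 * ∑ a, v a ^ 3) := by
  have weight_paths :
      ∑ b, ∑ p ∈ (G.neighborFinset b).offDiag, (u p.1 * u p.2) ^ 3 ≤ k * (∑ a, u a ^ 3) ^ 2 := by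
    refine (sum_offDiag_neighborFinset_le hG fun p =>
      pow_nonneg (mul_nonneg (hu p.1) (hu p.2)) 3).trans_eq ?_
    simp only [mul_pow, sq, sum_mul_sum, ← univ_product_univ, sum_product]
  have weight_centres :
      ∑ b, ∑ _p ∈ (G.neighborFinset b).offDiag, v b ^ 3 ≤ d ^ 2 * ∑ a, v a ^ 3 := by
    rw [mul_sum]
    refine sum_le_sum fun b _ => ?_
    rw [sum_const, nsmul_eq_mul]
    refine mul_le_mul_of_nonneg_right ?_ (pow_nonneg (hv b) 3)
    have : #(G.neighborFinset b).offDiag ≤ d ^ 2 := by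
      rw [offDiag_card, card_neighborFinset_eq_degree, ← sq]
      exact (Nat.sub_le _ _).trans (Nat.pow_le_pow_left (hd b) 2)
    exact_mod_cast this
  rw [sum_sigma'] at *
  have h := sum_sq_mul_pow_three_le
    (univ.sigma fun b => (G.neighborFinset b).offDiag) (u := fun x => u x.2.1 * u x.2.2)
    (v := fun x => v x.1) (fun x => mul_nonneg (hu _) (hu _)) (fun x => hv _)
  refine h.trans (mul_le_mul (pow_le_pow_left₀ (sum_nonneg fun x _ =>
    pow_nonneg (mul_nonneg (hu _) (hu _)) 3) weight_paths 2) weight_centres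
    (sum_nonneg fun x _ => pow_nonneg (hv _) 3) (sq_nonneg _))

lemma sum_neighborFinset_sq_mul_sq_pow_three_le {k d : ℕ} (hG : CodegreeLE G k)
    (hd : ∀ a, G.degree a ≤ d) {u v : V → ℝ} (hu : ∀ a, 0 ≤ u a) (hv : ∀ a, 0 ≤ v a) :
    (∑ b, ∑ a ∈ G.neighborFinset b, u a ^ 2 * v b ^ 2) ^ 3 ≤
      2 * (k + 1) * d * ((∑ a, u a ^ 3) ^ 2 * (∑ a, v a ^ 3) ^ 2) := by
  set U := ∑ a, u a ^ 3
  set W := ∑ a, v a ^ 3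
  set S := ∑ b, ∑ a ∈ G.neighborFinset b, u a ^ 2 * v b ^ 2
  set E := ∑ b, ∑ a ∈ G.neighborFinset b, (u a ^ 2) ^ 2 * v b
  set P := ∑ b, ∑ p ∈ (G.neighborFinset b).offDiag, (u p.1 * u p.2) ^ 2 * v b
  have : 0 ≤ U := sum_nonneg fun a _ => pow_nonneg (hu a) 3
  have hW : 0 ≤ W := sum_nonneg fun a _ => pow_nonneg (hv a) 3
  have hE : 0 ≤ E := sum_nonneg fun b _ => sum_nonneg fun a _ => mul_nonneg (sq_nonneg _) (hv b)
  have hP : 0 ≤ P := sum_nonneg fun b _ => sum_nonneg fun p _ => mul_nonneg (sq_nonneg _) (hv b)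
  have hE3 : E ^ 3 ≤ (d * U) ^ 2 * (U ^ 2 * W) := sum_edges_pow_three_le hd hu hv
  have hP3 : P ^ 3 ≤ (k * U ^ 2) ^ 2 * (d ^ 2 * W) := sum_paths_pow_three_le hG hd hu hv
  have cauchy_schwarz : S ^ 2 ≤ W * (E + P) := by
    have expand : E + P = ∑ b, v b * (∑ a ∈ G.neighborFinset b, u a ^ 2) ^ 2 := by
      simp only [E, P, sq_sum_eq_sum_sq_add_sum_offDiag, mul_comm (v _), add_mul, sum_mul,
        sum_add_distrib, mul_pow]
    rw [expand]
    refine sum_sq_le_sum_mul_sum_of_sq_le_mul _ (fun b _ => pow_nonneg (hv b) 3)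
      (fun b _ => mul_nonneg (hv b) (sq_nonneg _)) fun b _ => le_of_eq ?_
    rw [← sum_mul]
    ring
  have hEP : (E + P) ^ 3 ≤ 4 * (1 + k ^ 2) * d ^ 2 * (U ^ 4 * W) := by
    have := add_pow_le hE hP 3
    norm_num at this
    linarith
  refine le_of_sq_le_sq ?_ (by positivity)
  calc (S ^ 3) ^ 2 = (S ^ 2) ^ 3 := by ring
    _ ≤ (W * (E + P)) ^ 3 := pow_le_pow_left₀ (sq_nonneg S) cauchy_schwarz 3
    _ = W ^ 3 * (E + P) ^ 3 := mul_pow _ _ _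
    _ ≤ W ^ 3 * (4 * (1 + k) ^ 2 * d ^ 2 * (U ^ 4 * W)) := by
      gcongr
      refine hEP.trans ?_
      gcongr
      nlinarith [k.cast_nonneg (α := ℝ)]
    _ = (2 * (k + 1) * d * (U ^ 2 * W ^ 2)) ^ 2 := by ring

lemma sum_triangles_sq_mul_sq_pow_three_le {k d : ℕ} (hG : CodegreeLE G k)
    (hd : ∀ a, G.degree a ≤ d) {u v : V → ℝ} (hu : ∀ a, 0 ≤ u a) (hv : ∀ a, 0 ≤ v a) :
    (∑ x ∈ triangles G, u x.1 ^ 2 * v x.2.1 ^ 2) ^ 3 ≤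
      2 * k ^ 3 * (k + 1) * d * ((∑ a, u a ^ 3) ^ 2 * (∑ a, v a ^ 3) ^ 2) := by
  have hT : 0 ≤ ∑ x ∈ triangles G, u x.1 ^ 2 * v x.2.1 ^ 2 := sum_nonneg fun x _ => by positivity
  have edges := sum_triangles_edge_le hG (φ := fun a b => u a ^ 2 * v b ^ 2)
    fun a b => by positivity
  calc _ ≤ (k * ∑ b, ∑ a ∈ G.neighborFinset b, u a ^ 2 * v b ^ 2) ^ 3 :=
        pow_le_pow_left₀ hT edges 3
    _ ≤ k ^ 3 * (2 * (k + 1) * d * ((∑ a, u a ^ 3) ^ 2 * (∑ a, v a ^ 3) ^ 2)) := by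
        rw [mul_pow]
        exact mul_le_mul_of_nonneg_left (sum_neighborFinset_sq_mul_sq_pow_three_le hG hd hu hv)
          (by positivity)
    _ = _ := by ring

lemma sum_sq_sum_inter_neighborFinset_le {k : ℕ} {s : Finset V}
    (hs : ∀ a ∈ s, #(s ∩ G.neighborFinset a) ≤ k) (g : V → ℝ) :
    ∑ a ∈ s, (∑ c ∈ s ∩ G.neighborFinset a, g c) ^ 2 ≤ k ^ 2 * ∑ c ∈ s, g c ^ 2 := by
  have comm : ∑ a ∈ s, ∑ c ∈ s ∩ G.neighborFinset a, g c ^ 2 =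
      ∑ c ∈ s, ∑ _a ∈ s ∩ G.neighborFinset c, g c ^ 2 :=
    sum_comm' fun a c => by simp [G.adj_comm a]; tauto
  calc ∑ a ∈ s, (∑ c ∈ s ∩ G.neighborFinset a, g c) ^ 2
      ≤ ∑ a ∈ s, k * ∑ c ∈ s ∩ G.neighborFinset a, g c ^ 2 := by
        refine sum_le_sum fun a ha => sq_sum_le_card_mul_sum_sq.trans ?_
        exact mul_le_mul_of_nonneg_right (by exact_mod_cast hs a ha)
          (sum_nonneg fun c _ => sq_nonneg _)
    _ = k * ∑ c ∈ s, #(s ∩ G.neighborFinset c) * g c ^ 2 := by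
        simp only [← mul_sum, comm, sum_const, nsmul_eq_mul]
    _ ≤ k * ∑ c ∈ s, k * g c ^ 2 := by
        gcongr with c hc
        exact hs c hc
    _ = k ^ 2 * ∑ c ∈ s, g c ^ 2 := by rw [← mul_sum]; ring

lemma sq_sum_mul_sum_inter_neighborFinset_le {k : ℕ} {s : Finset V}
    (hs : ∀ a ∈ s, #(s ∩ G.neighborFinset a) ≤ k) (f g : V → ℝ) :
    (∑ a ∈ s, f a * ∑ c ∈ s ∩ G.neighborFinset a, g c) ^ 2 ≤
      2 * k * (k + 1) * ∑ p ∈ s.offDiag, f p.1 ^ 2 * g p.2 ^ 2 := by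
  obtain rfl | hne := s.eq_empty_or_nonempty
  · simp
  -- Cauchy–Schwarz alone would leave the diagonal terms `f a ^ 2 * g a ^ 2`; treating the largest
  -- value of `f` separately makes room for them off the diagonal.
  obtain ⟨m, hm, f_le⟩ := s.exists_max_image (fun a => f a ^ 2) hne
  set h : V → ℝ := fun a => ∑ c ∈ s ∩ G.neighborFinset a, g c
  set D : ℝ := ∑ p ∈ s.offDiag, f p.1 ^ 2 * g p.2 ^ 2 with hD
  have max_le : (f m * h m) ^ 2 ≤ k * D := by
    have row_le : f m ^ 2 * ∑ c ∈ s.erase m, g c ^ 2 ≤ D := by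
      rw [hD, sum_offDiag, mul_sum]
      exact single_le_sum (f := fun a => ∑ c ∈ s.erase a, f a ^ 2 * g c ^ 2)
        (fun a _ => by positivity) hm
    have subset_erase : s ∩ G.neighborFinset m ⊆ s.erase m := fun c hc =>
      mem_erase.2 ⟨(G.ne_of_adj (by simpa using (mem_inter.1 hc).2)).symm, (mem_inter.1 hc).1⟩
    calc (f m * h m) ^ 2
        ≤ f m ^ 2 * (#(s ∩ G.neighborFinset m) * ∑ c ∈ s ∩ G.neighborFinset m, g c ^ 2) := by
          rw [mul_pow]
          gcongr
          exact sq_sum_le_card_mul_sum_sq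
      _ ≤ f m ^ 2 * (k * ∑ c ∈ s.erase m, g c ^ 2) := by
          gcongr
          exact hs m hm
      _ ≤ k * D := by
          rw [mul_left_comm]
          gcongr
  have rest_le : (∑ a ∈ s.erase m, f a * h a) ^ 2 ≤ k ^ 2 * D :=
    calc (∑ a ∈ s.erase m, f a * h a) ^ 2
        ≤ (∑ a ∈ s.erase m, f a ^ 2) * ∑ a ∈ s, h a ^ 2 := by
          refine (sum_mul_sq_le_sq_mul_sq _ f h).trans ?_
          gcongr
          exact erase_subset m s
      _ ≤ (∑ a ∈ s.erase m, f a ^ 2) * (k ^ 2 * ∑ c ∈ s, g c ^ 2) := by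
          gcongr
          exact sum_sq_sum_inter_neighborFinset_le hs g
      _ ≤ k ^ 2 * D := by
          rw [mul_left_comm]
          gcongr
          exact sum_erase_mul_sum_le_sum_offDiag hm f_le fun c => sq_nonneg (g c)
  rw [← add_sum_erase s _ hm]
  linarith [add_sq_le (a := f m * h m) (b := ∑ a ∈ s.erase m, f a * h a)]

lemma sq_triangleSum_le {k : ℕ} (hG : CodegreeLE G k) (f₁ f₂ f₃ : V → ℝ) :
    triangleSum G f₁ f₂ f₃ ^ 2 ≤ 2 * k ^ 2 * (k + 1) *
      ((∑ a, f₁ a ^ 2) * (∑ a, f₂ a ^ 2) * ∑ a, f₃ a ^ 2) := by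
  set L : V → ℝ := fun b => ∑ a ∈ G.neighborFinset b,
    f₁ a * ∑ c ∈ G.neighborFinset b ∩ G.neighborFinset a, f₃ c
  have link : ∀ b, L b ^ 2 ≤
      2 * k * (k + 1) * ∑ p ∈ (G.neighborFinset b).offDiag, f₁ p.1 ^ 2 * f₃ p.2 ^ 2 := fun b =>
    sq_sum_mul_sum_inter_neighborFinset_le
      (fun a ha => hG (G.ne_of_adj (by simpa using ha))) f₁ f₃
  have paths : ∑ b, ∑ p ∈ (G.neighborFinset b).offDiag, f₁ p.1 ^ 2 * f₃ p.2 ^ 2 ≤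
      k * ((∑ a, f₁ a ^ 2) * ∑ a, f₃ a ^ 2) := by
    refine (sum_offDiag_neighborFinset_le hG fun p => by positivity).trans_eq ?_
    simp only [sum_mul_sum, ← univ_product_univ, sum_product]
  calc triangleSum G f₁ f₂ f₃ ^ 2 = (∑ b, f₂ b * L b) ^ 2 := by
        rw [triangleSum, sum_triangles_eq fun a b c => f₁ a * f₂ b * f₃ c]
        simp only [L, mul_sum, mul_assoc, mul_left_comm (f₂ _)]
    _ ≤ (∑ b, f₂ b ^ 2) * ∑ b, L b ^ 2 := sum_mul_sq_le_sq_mul_sq _ _ _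
    _ ≤ (∑ b, f₂ b ^ 2) * (2 * k * (k + 1) *
          (k * ((∑ a, f₁ a ^ 2) * ∑ a, f₃ a ^ 2))) := by
        gcongr
        refine (sum_le_sum fun b _ => link b).trans ?_
        rw [← mul_sum]
        gcongr
    _ = _ := by ring


lemma sum_triangles_subdensity_le {k d : ℕ} (hG : CodegreeLE G k) (hd : ∀ a, G.degree a ≤ d)
    (hV : Fintype.card V ≤ d ^ 2) {g : V → ℝ} (hg : IsSubdensity g) :
    ∑ x ∈ triangles G, g x.1 ≤ 2 * k ^ 2 * d ^ 3 := by
  have k_le : (k : ℝ) ≤ 2 * k ^ 2 := by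
    exact_mod_cast (Nat.le_self_pow two_ne_zero k).trans (Nat.le_mul_of_pos_left _ two_pos)
  calc ∑ x ∈ triangles G, g x.1 ≤ k * (d * ∑ a, g a) := sum_triangles_vertex_le hG hd hg.1
    _ ≤ 2 * k ^ 2 * (d * d ^ 2) :=
        mul_le_mul k_le (mul_le_mul_of_nonneg_left (hg.sum_le hV) d.cast_nonneg)
          (mul_nonneg d.cast_nonneg (sum_nonneg fun a _ => hg.1 a)) (by positivity)
    _ = 2 * k ^ 2 * d ^ 3 := by ring

lemma sum_triangles_cbrt_subdensity_le {k d : ℕ} (hG : CodegreeLE G k)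
    (hd : ∀ a, G.degree a ≤ d) (hV : Fintype.card V ≤ d ^ 2) {g₁ g₂ : V → ℝ}
    (h₁ : IsSubdensity g₁) (h₂ : IsSubdensity g₂) :
    ∑ x ∈ triangles G, (g₁ x.1 ^ (1 / 3 : ℝ)) ^ 2 * (g₂ x.2.1 ^ (1 / 3 : ℝ)) ^ 2 ≤
      2 * k ^ 2 * d ^ 3 := by
  have cube_cbrt : ∀ {z : ℝ}, 0 ≤ z → (z ^ (1 / 3 : ℝ)) ^ 3 = z := fun hz => by
    rw [← Real.rpow_natCast, ← Real.rpow_mul hz]; norm_num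
  have h := sum_triangles_sq_mul_sq_pow_three_le hG hd (fun a => Real.rpow_nonneg (h₁.1 a) (1 / 3))
    (fun a => Real.rpow_nonneg (h₂.1 a) (1 / 3))
  simp only [cube_cbrt (h₁.1 _), cube_cbrt (h₂.1 _)] at h
  refine le_of_pow_le_pow_left₀ three_ne_zero (by positivity) (h.trans ?_)
  have k_le_sq : (k : ℝ) ≤ k ^ 2 := by exact_mod_cast Nat.le_self_pow two_ne_zero k
  have sq_le : (k : ℝ) ^ 2 ≤ (k ^ 2) ^ 2 := by
    exact_mod_cast Nat.le_self_pow two_ne_zero (k ^ 2)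
  have k_le : (2 : ℝ) * k ^ 3 * (k + 1) ≤ (2 * k ^ 2) ^ 3 :=
    calc (2 * k ^ 3 * (k + 1) : ℝ) = (2 * k ^ 2 * (k ^ 2 + k) : ℝ) := by ring
      _ ≤ (2 * k ^ 2 * (4 * (k ^ 2) ^ 2) : ℝ) := by
          gcongr
          linarith [sq_nonneg ((k : ℝ) ^ 2)]
      _ = ((2 * k ^ 2) ^ 3 : ℝ) := by ring
  have n₁ : 0 ≤ ∑ a, g₁ a := sum_nonneg fun a _ => h₁.1 a
  have n₂ : 0 ≤ ∑ a, g₂ a := sum_nonneg fun a _ => h₂.1 a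
  calc _ ≤ (2 * (k : ℝ) ^ 2) ^ 3 * d * (((d : ℝ) ^ 2) ^ 2 * ((d : ℝ) ^ 2) ^ 2) := by
        gcongr
        · exact h₁.sum_le hV
        · exact h₂.sum_le hV
    _ = _ := by ring

lemma triangleSum_sqrt_subdensity_le {k d : ℕ} (hG : CodegreeLE G k)
    (hV : Fintype.card V ≤ d ^ 2) {g₁ g₂ g₃ : V → ℝ} (h₁ : IsSubdensity g₁)
    (h₂ : IsSubdensity g₂) (h₃ : IsSubdensity g₃) :
    triangleSum G (fun a => √(g₁ a)) (fun a => √(g₂ a)) (fun a => √(g₃ a)) ≤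
      2 * k ^ 2 * d ^ 3 := by
  have h := sq_triangleSum_le hG (fun a => √(g₁ a)) (fun a => √(g₂ a)) (fun a => √(g₃ a))
  simp only [Real.sq_sqrt (h₁.1 _), Real.sq_sqrt (h₂.1 _), Real.sq_sqrt (h₃.1 _)] at h
  refine le_of_sq_le_sq (h.trans ?_) (by positivity)
  have k_le_sq : (k : ℝ) ≤ k ^ 2 := by exact_mod_cast Nat.le_self_pow two_ne_zero k
  have k_le : (2 : ℝ) * k ^ 2 * (k + 1) ≤ (2 * k ^ 2) ^ 2 :=
    calc (2 * k ^ 2 * (k + 1) : ℝ) = (2 * k * (k ^ 2 + k) : ℝ) := by ring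
      _ ≤ (2 * k ^ 2 * (k ^ 2 + k ^ 2) : ℝ) := by gcongr
      _ = ((2 * k ^ 2) ^ 2 : ℝ) := by ring
  have n₁ : 0 ≤ ∑ a, g₁ a := sum_nonneg fun a _ => h₁.1 a
  have n₂ : 0 ≤ ∑ a, g₂ a := sum_nonneg fun a _ => h₂.1 a
  have n₃ : 0 ≤ ∑ a, g₃ a := sum_nonneg fun a _ => h₃.1 a
  calc _ ≤ (2 * (k : ℝ) ^ 2) ^ 2 * ((d : ℝ) ^ 2 * (d : ℝ) ^ 2 * (d : ℝ) ^ 2) := by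
        gcongr
        · exact h₁.sum_le hV
        · exact h₂.sum_le hV
        · exact h₃.sum_le hV
    _ = _ := by ring

lemma rpow_mul_rpow_mul_rpow_le {u₁ u₂ u₃ : ℝ} (h₃ : 0 ≤ u₃) (h₃₂ : u₃ ≤ u₂) (h₂₁ : u₂ ≤ u₁)
    (hu : 2 * u₁ + u₂ + u₃ ≤ 2) {x y z : ℝ} (hx : 0 ≤ x) (hy : 0 ≤ y) (hz : 0 ≤ z) :
    x ^ u₁ * y ^ u₂ * z ^ u₃ ≤
      2 * u₃ * (√x * √y * √z) +
        3 / 2 * (u₂ - u₃) * ((x ^ (1 / 3 : ℝ)) ^ 2 * (y ^ (1 / 3 : ℝ)) ^ 2) +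
        (u₁ - u₂) * x + (1 - (u₁ + u₂ / 2 + u₃ / 2)) * 1 := by
  have : 0 ≤ u₂ - u₃ := sub_nonneg.2 h₃₂
  have h₁₂ : 0 ≤ u₁ - u₂ := sub_nonneg.2 h₂₁
  refine le_trans (le_of_eq ?_) (Real.geom_mean_le_arith_mean4_weighted
    (by positivity) (by positivity) h₁₂ (by linarith) (by positivity) (by positivity) hx
    zero_le_one (by ring))
  have x_eq : x ^ u₁ = (√x) ^ (2 * u₃) * ((x ^ (1 / 3 : ℝ)) ^ 2) ^ (3 / 2 * (u₂ - u₃)) *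
      x ^ (u₁ - u₂) := by
    rw [Real.sqrt_eq_rpow, ← Real.rpow_natCast, ← Real.rpow_mul hx, ← Real.rpow_mul hx,
      ← Real.rpow_mul hx, ← Real.rpow_add_of_nonneg hx (by positivity) (by positivity),
      ← Real.rpow_add_of_nonneg hx (by positivity) (by positivity)]
    congr 1
    push_cast
    ring
  have y_eq : y ^ u₂ = (√y) ^ (2 * u₃) * ((y ^ (1 / 3 : ℝ)) ^ 2) ^ (3 / 2 * (u₂ - u₃)) := by
    rw [Real.sqrt_eq_rpow, ← Real.rpow_natCast, ← Real.rpow_mul hy, ← Real.rpow_mul hy,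
      ← Real.rpow_mul hy, ← Real.rpow_add_of_nonneg hy (by positivity) (by positivity)]
    congr 1
    push_cast
    ring
  have z_eq : z ^ u₃ = (√z) ^ (2 * u₃) := by
    rw [Real.sqrt_eq_rpow, ← Real.rpow_mul hz]
    congr 1
    ring
  rw [Real.one_rpow, mul_one, Real.mul_rpow (by positivity) (by positivity),
    Real.mul_rpow (by positivity) (by positivity), Real.mul_rpow (by positivity) (by positivity),
    x_eq, y_eq, z_eq]
  ring

lemma triangleSum_rpow_le_of_antitone {k d : ℕ} (hG : CodegreeLE G k)
    (hd : ∀ a, G.degree a ≤ d) (hV : Fintype.card V ≤ d ^ 2) {g₁ g₂ g₃ : V → ℝ}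
    (h₁ : IsSubdensity g₁) (h₂ : IsSubdensity g₂) (h₃ : IsSubdensity g₃) {u₁ u₂ u₃ : ℝ}
    (hu₃ : 0 ≤ u₃) (h₃₂ : u₃ ≤ u₂) (h₂₁ : u₂ ≤ u₁) (hu : 2 * u₁ + u₂ + u₃ ≤ 2) :
    triangleSum G (fun a => g₁ a ^ u₁) (fun a => g₂ a ^ u₂) (fun a => g₃ a ^ u₃) ≤
      2 * k ^ 2 * d ^ 3 := by
  set B : ℝ := 2 * k ^ 2 * d ^ 3
  have half := triangleSum_sqrt_subdensity_le hG hV h₁ h₂ h₃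
  have third := sum_triangles_cbrt_subdensity_le hG hd hV h₁ h₂
  have vertex := sum_triangles_subdensity_le hG hd hV h₁
  have count : ∑ _x ∈ triangles G, (1 : ℝ) ≤ B :=
    sum_triangles_subdensity_le (g := fun _ => 1) hG hd hV ⟨fun _ => zero_le_one, by simp⟩
  have : 0 ≤ u₂ - u₃ := sub_nonneg.2 h₃₂
  have : 0 ≤ u₁ - u₂ := sub_nonneg.2 h₂₁
  have hu' : 0 ≤ 1 - (u₁ + u₂ / 2 + u₃ / 2) := by linarith
  calc triangleSum G (fun a => g₁ a ^ u₁) (fun a => g₂ a ^ u₂) (fun a => g₃ a ^ u₃)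
      ≤ ∑ x ∈ triangles G, _ := sum_le_sum fun x _ =>
        rpow_mul_rpow_mul_rpow_le hu₃ h₃₂ h₂₁ hu (h₁.1 x.1) (h₂.1 x.2.1) (h₃.1 x.2.2)
    _ ≤ 2 * u₃ * B + 3 / 2 * (u₂ - u₃) * B + (u₁ - u₂) * B +
          (1 - (u₁ + u₂ / 2 + u₃ / 2)) * B := by
        simp only [sum_add_distrib, ← mul_sum]
        gcongr
        exact half
    _ = B := by ring

theorem triangleSum_rpow_le {k d : ℕ} (hG : CodegreeLE G k)
    (hd : ∀ a, G.degree a ≤ d) (hV : Fintype.card V ≤ d ^ 2) {g₁ g₂ g₃ : V → ℝ}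
    (h₁ : IsSubdensity g₁) (h₂ : IsSubdensity g₂) (h₃ : IsSubdensity g₃) {u₁ u₂ u₃ : ℝ}
    (hu₁ : 0 ≤ u₁) (hu₂ : 0 ≤ u₂) (hu₃ : 0 ≤ u₃) (e₁ : 2 * u₁ + u₂ + u₃ ≤ 2)
    (e₂ : u₁ + 2 * u₂ + u₃ ≤ 2) (e₃ : u₁ + u₂ + 2 * u₃ ≤ 2) :
    triangleSum G (fun a => g₁ a ^ u₁) (fun a => g₂ a ^ u₂) (fun a => g₃ a ^ u₃) ≤
      2 * k ^ 2 * d ^ 3 := by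
  wlog h₂₁ : u₂ ≤ u₁ generalizing u₁ u₂ u₃ g₁ g₂ g₃
  · rw [← triangleSum_swap]
    exact this h₂ h₁ h₃ hu₂ hu₁ hu₃ (by linarith) (by linarith) (by linarith)
      (le_of_not_ge h₂₁)
  wlog h₃₁ : u₃ ≤ u₁ generalizing u₁ u₂ u₃ g₁ g₂ g₃
  · rw [← triangleSum_rotate, ← triangleSum_rotate]
    exact this h₃ h₁ h₂ hu₃ hu₁ hu₂ (by linarith) (by linarith) (by linarith)
      (le_of_not_ge h₃₁) (by linarith)
  wlog h₃₂ : u₃ ≤ u₂ generalizing u₂ u₃ g₂ g₃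
  · rw [← triangleSum_rotate, triangleSum_swap, triangleSum_rotate]
    exact this h₃ h₂ hu₃ hu₂ (by linarith) (by linarith) (by linarith) h₃₁ h₂₁
      (le_of_not_ge h₃₂)
  exact triangleSum_rpow_le_of_antitone hG hd hV h₁ h₂ h₃ hu₃ h₃₂ h₂₁ e₁

end Graph

section Circle

open Finset

variable {F : Type} [Field F] {t : F}

lemma mem_circle {x : Plane F} : x ∈ circle t ↔ x 0 ^ 2 + x 1 ^ 2 = t := Iff.rfl

lemma ne_zero_of_mem_circle (ht : t ≠ 0) {x : Plane F} (hx : x ∈ circle t) : x ≠ 0 := by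
  rintro rfl
  exact ht (by simpa [mem_circle] using hx.symm)

lemma neg_mem_circle {x : Plane F} (hx : x ∈ circle t) : -x ∈ circle t := by
  simpa [mem_circle] using hx

/-- The graph of the pairs of points at distance `t`, so that a copy of `K₃` with all sides `t` is
a triangle of this graph. -/
def circleGraph (ht : t ≠ 0) : SimpleGraph (Plane F) where
  Adj a b := a - b ∈ circle t
  symm := ⟨fun a b h => by simpa using neg_mem_circle h⟩
  loopless := ⟨fun a h => ne_zero_of_mem_circle ht h (sub_self a)⟩

lemma circleGraph_adj (ht : t ≠ 0) {a b : Plane F} :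
    (circleGraph ht).Adj a b ↔ a - b ∈ circle t := Iff.rfl

instance [DecidableEq F] (t : F) : DecidablePred (· ∈ circle t) := fun x =>
  inferInstanceAs (Decidable (x 0 ^ 2 + x 1 ^ 2 = t))

instance [DecidableEq F] (ht : t ≠ 0) : DecidableRel (circleGraph ht).Adj := fun a b =>
  inferInstanceAs (Decidable (a - b ∈ circle t))

lemma exists_mem_circle_sub_mem_circle (h2 : (2 : F) ≠ 0) (h3 : IsSquare (3 : F)) :
    ∃ R : Plane F → Plane F, ∀ x ∈ circle t, R x ∈ circle t ∧ x - R x ∈ circle t := by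
  obtain ⟨r, hr⟩ := h3
  refine ⟨fun x => ![(x 0 - r * x 1) / 2, (r * x 0 + x 1) / 2], fun x hx => ?_⟩
  simp only [mem_circle, Pi.sub_apply, Matrix.cons_val_zero, Matrix.cons_val_one] at hx ⊢
  constructor <;> field_simp <;> linear_combination 4 * hx - (x 0 ^ 2 + x 1 ^ 2) * hr

lemma circle_nonempty [Finite F] (h2 : (2 : F) ≠ 0) (t : F) : (circle t).Nonempty := by
  have := Fintype.ofFinite F
  have odd_card : Fintype.card F % 2 = 1 :=
    FiniteField.odd_card_of_char_ne_two fun h => h2 <| by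
      exact_mod_cast (ringChar.spec F 2).2 (dvd_of_eq h)
  obtain ⟨a, b, h⟩ := FiniteField.exists_root_sum_quadratic
    (f := (Polynomial.X ^ 2 : Polynomial F)) (g := Polynomial.X ^ 2 - Polynomial.C t) (by simp)
    (Polynomial.degree_X_pow_sub_C two_pos t) odd_card
  simp only [Polynomial.eval_pow, Polynomial.eval_X, Polynomial.eval_sub,
    Polynomial.eval_C] at h
  refine ⟨![a, b], ?_⟩
  simp only [mem_circle, Matrix.cons_val_zero, Matrix.cons_val_one]
  linear_combination h

lemma ncard_circle_pos [Finite F] (h2 : (2 : F) ≠ 0) (t : F) : 0 < (circle t).ncard :=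
  (Set.ncard_pos (Set.toFinite _)).2 (circle_nonempty h2 t)

variable [Fintype F]

lemma card_sq_eq_le_two [DecidableEq F] (s : F) : #{y : F | y ^ 2 = s} ≤ 2 :=
  calc #{y : F | y ^ 2 = s} ≤ #(Polynomial.nthRoots 2 s).toFinset :=
        card_le_card fun y hy => by simpa [Polynomial.mem_nthRoots two_pos] using hy
    _ ≤ 2 := (Multiset.toFinset_card_le _).trans (Polynomial.card_nthRoots 2 s)

lemma ncard_circle [DecidableEq F] (t : F) : (circle t).ncard = #{x : Plane F | x ∈ circle t} := by
  simp [← Set.ncard_coe_finset]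

lemma ncard_circle_le (t : F) : (circle t).ncard ≤ 2 * Fintype.card F := by
  classical
  rw [ncard_circle]
  refine (card_le_mul_card_image (f := fun x : Plane F => x 0) _ 2 fun a _ => ?_).trans
    (Nat.mul_le_mul_left 2 (card_le_univ _))
  refine (card_le_card_of_injOn (fun x => x 1) (fun x hx => ?_) fun x hx y hy hxy => ?_).trans
    (card_sq_eq_le_two (t - a ^ 2))
  · obtain ⟨hxt, rfl⟩ : x 0 ^ 2 + x 1 ^ 2 = t ∧ x 0 = a := by simpa [mem_circle] using hx
    simpa using eq_sub_of_add_eq' hxt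
  · have hx0 : x 0 = a := by simp_all
    have hy0 : y 0 = a := by simp_all
    ext i
    fin_cases i
    exacts [hx0.trans hy0.symm, hxy]

-- Stereographic projection from a point `p` of the circle: the line through `p` of slope `m` meets
-- the circle once more, unless it is isotropic or tangent; a tangent line is sent to `p` itself.
lemma card_le_ncard_circle_add_two (h2 : (2 : F) ≠ 0) (ht : t ≠ 0) :
    Fintype.card F ≤ (circle t).ncard + 2 := by
  classical
  obtain ⟨p, hp⟩ := circle_nonempty h2 t
  set s : F → F := fun m => -2 * (p 0 + p 1 * m) / (1 + m ^ 2)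
  have s_mul {m : F} (hm : 1 + m ^ 2 ≠ 0) : s m * (1 + m ^ 2) = -2 * (p 0 + p 1 * m) :=
    div_mul_cancel₀ _ hm
  have non_isotropic : #{m : F | 1 + m ^ 2 ≠ 0} ≤ (circle t).ncard := by
    rw [ncard_circle]
    refine card_le_card_of_injOn (fun m => ![p 0 + s m, p 1 + s m * m])
      (fun m hm => ?_) fun m hm n hn hmn => ?_
    · have hm : 1 + m ^ 2 ≠ 0 := by simpa using hm
      rw [mem_circle] at hp
      simp only [coe_filter, mem_univ, true_and, Set.mem_ofPred_eq, mem_circle,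
        Matrix.cons_val_zero, Matrix.cons_val_one]
      linear_combination hp + s m * s_mul hm
    · have hm : 1 + m ^ 2 ≠ 0 := by simpa using hm
      have hn : 1 + n ^ 2 ≠ 0 := by simpa using hn
      have s_eq : s m = s n := by simpa using congrFun hmn 0
      have s_mul_eq : s m * m = s n * n := by simpa using congrFun hmn 1
      by_contra h_ne
      have sub_ne : m - n ≠ 0 := sub_ne_zero.2 h_ne
      have s_zero : s m = 0 := (mul_eq_zero.1 (by linear_combination s_mul_eq - n * s_eq :
        s m * (m - n) = 0)).resolve_right sub_ne
      have tangent_m : p 0 + p 1 * m = 0 :=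
        mul_left_cancel₀ h2 (by linear_combination s_mul hm - (1 + m ^ 2) * s_zero)
      have tangent_n : p 0 + p 1 * n = 0 :=
        mul_left_cancel₀ h2 (by
          linear_combination s_mul hn - (1 + n ^ 2) * s_zero + (1 + n ^ 2) * s_eq)
      have p_one : p 1 = 0 := (mul_eq_zero.1 (by linear_combination tangent_m - tangent_n :
        p 1 * (m - n) = 0)).resolve_right sub_ne
      have p_zero : p 0 = 0 := by simpa [p_one] using tangent_m
      exact ht (by simpa [mem_circle, p_zero, p_one] using hp.symm)
  have isotropic : #{m : F | ¬1 + m ^ 2 ≠ 0} ≤ 2 := by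
    simpa only [not_not, add_eq_zero_iff_eq_neg'] using card_sq_eq_le_two (-1 : F)
  rw [← card_univ, ← card_filter_add_card_filter_not (fun m : F => 1 + m ^ 2 ≠ 0)]
  exact add_le_add non_isotropic isotropic

lemma card_le_three_mul_ncard_circle (h2 : (2 : F) ≠ 0) (ht : t ≠ 0) :
    Fintype.card F ≤ 3 * (circle t).ncard := by
  have := card_le_ncard_circle_add_two h2 ht
  have := ncard_circle_pos h2 t
  omega

lemma degree_circleGraph [DecidableEq F] (ht : t ≠ 0) (a : Plane F) :
    (circleGraph ht).degree a = (circle t).ncard := by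
  rw [ncard_circle, ← SimpleGraph.card_neighborFinset_eq_degree]
  refine card_bij' (fun b _ => a - b) (fun b _ => a - b) ?_ ?_ ?_ ?_ <;> simp [circleGraph_adj]

lemma card_mem_circle_sub_mem_circle_le [DecidableEq F] (h2 : (2 : F) ≠ 0) (ht : t ≠ 0)
    {d : Plane F} (hd : d ≠ 0) : #{v | v ∈ circle t ∧ v - d ∈ circle t} ≤ 2 := by
  set N := d 0 ^ 2 + d 1 ^ 2
  set γ : Plane F → F := fun v => 2 * (v 0 * d 1 - v 1 * d 0)
  have inner_eq {v : Plane F} (hv : v ∈ circle t ∧ v - d ∈ circle t) :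
      2 * (v 0 * d 0 + v 1 * d 1) = N := by
    simp only [mem_circle, Pi.sub_apply] at hv
    linear_combination hv.1 - hv.2
  have γ_sq {v : Plane F} (hv : v ∈ circle t ∧ v - d ∈ circle t) :
      γ v ^ 2 = 4 * t * N - N ^ 2 := by
    have hv₁ := mem_circle.1 hv.1
    linear_combination 4 * N * hv₁ - (2 * (v 0 * d 0 + v 1 * d 1) + N) * inner_eq hv
  have two_mul_N {v : Plane F} (hv : v ∈ circle t ∧ v - d ∈ circle t) :
      2 * N * v 0 = d 0 * N + d 1 * γ v ∧ 2 * N * v 1 = d 1 * N - d 0 * γ v := by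
    constructor
    · linear_combination d 0 * inner_eq hv
    · linear_combination d 1 * inner_eq hv
  have N_ne_zero {v : Plane F} (hv : v ∈ circle t ∧ v - d ∈ circle t) : N ≠ 0 := by
    intro hN
    have hγ : γ v = 0 := by simpa [hN] using γ_sq hv
    have hv₁ := mem_circle.1 hv.1
    have h2t : 2 * t ≠ 0 := mul_ne_zero h2 ht
    refine hd (funext fun i => mul_left_cancel₀ h2t ?_)
    fin_cases i
    · change 2 * t * d 0 = 2 * t * 0
      linear_combination -2 * d 0 * hv₁ + v 0 * (inner_eq hv).trans hN - v 1 * hγ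
    · change 2 * t * d 1 = 2 * t * 0
      linear_combination -2 * d 1 * hv₁ + v 1 * (inner_eq hv).trans hN + v 0 * hγ
  refine (card_le_card_of_injOn γ (fun v hv => ?_) fun v hv w hw hvw => ?_).trans
    (card_sq_eq_le_two (4 * t * N - N ^ 2))
  · simpa using γ_sq (by simpa using hv)
  · have hv : v ∈ circle t ∧ v - d ∈ circle t := by simpa using hv
    have hw : w ∈ circle t ∧ w - d ∈ circle t := by simpa using hw
    refine funext fun i => mul_left_cancel₀ (mul_ne_zero h2 (N_ne_zero hv)) ?_
    fin_cases i
    · exact (two_mul_N hv).1.trans (hvw ▸ (two_mul_N hw).1.symm)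
    · exact (two_mul_N hv).2.trans (hvw ▸ (two_mul_N hw).2.symm)

lemma codegreeLE_two_circleGraph [DecidableEq F] (h2 : (2 : F) ≠ 0) (ht : t ≠ 0) :
    CodegreeLE (circleGraph ht) 2 := by
  intro a b hab
  refine (card_le_card_of_injOn (fun c => a - c) (fun c hc => ?_)
    fun c _ c' _ h => sub_right_injective h).trans
    (card_mem_circle_sub_mem_circle_le h2 ht (sub_ne_zero.2 hab))
  simpa [circleGraph_adj] using hc

lemma form_eq_triangleSum [DecidableEq F] (ht : t ≠ 0) (f₁ f₂ f₃ : Plane F → ℝ) :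
    form t f₁ f₂ f₃ = 1 / ((Fintype.card F : ℝ) ^ 2 * ((circle t).ncard : ℝ)) *
      triangleSum (circleGraph ht) f₁ f₂ f₃ := by
  rw [form, triangleSum, triangles, sum_filter, Fintype.sum_prod_type]
  congr 1
  refine sum_congr rfl fun a _ => ?_
  rw [Fintype.sum_prod_type]
  refine sum_congr rfl fun b _ => sum_congr rfl fun c _ => ?_
  simp only [ind, Set.indicator_apply, circleGraph_adj]
  split_ifs <;> simp_all

lemma form_swap (ht : t ≠ 0) (f₁ f₂ f₃ : Plane F → ℝ) :
    form t f₂ f₁ f₃ = form t f₁ f₂ f₃ := by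
  classical
  rw [form_eq_triangleSum ht, form_eq_triangleSum ht, triangleSum_swap]

lemma form_rotate (ht : t ≠ 0) (f₁ f₂ f₃ : Plane F → ℝ) :
    form t f₂ f₃ f₁ = form t f₁ f₂ f₃ := by
  classical
  rw [form_eq_triangleSum ht, form_eq_triangleSum ht, triangleSum_rotate]

end Circle

section Norm

open Finset

variable {F : Type} [Fintype F]

lemma abs_le_lpNorm_top (f : Plane F → ℝ) (x : Plane F) : |f x| ≤ lpNorm ∞ f := by
  rw [lpNorm, if_pos rfl]
  exact le_ciSup (f := fun x => |f x|) (Set.finite_range _).bddAbove x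

variable [Field F] {p : ℝ≥0∞}

lemma cast_card_pos : (0 : ℝ) < Fintype.card F := Nat.cast_pos.2 Fintype.card_pos

lemma card_sq_mul_lpNorm_rpow (hp : p ≠ 0) (hp' : p ≠ ∞) (f : Plane F → ℝ) :
    (Fintype.card F : ℝ) ^ 2 * lpNorm p f ^ p.toReal = ∑ x, |f x| ^ p.toReal := by
  rw [lpNorm, if_neg hp', one_div,
    Real.rpow_inv_rpow (by positivity) (ENNReal.toReal_pos hp hp').ne',
    mul_inv_cancel_left₀ (by positivity)]

lemma exists_isSubdensity (hp : 1 ≤ p) {f : Plane F → ℝ} (hf : ∀ x, 0 ≤ f x) :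
    ∃ g : Plane F → ℝ, IsSubdensity g ∧ ∀ x, f x ≤ lpNorm p f * g x ^ (p⁻¹).toReal := by
  obtain rfl | hp' := eq_or_ne p ∞
  · exact ⟨fun _ => 1, ⟨fun _ => zero_le_one, by simp⟩, fun x => by
      simpa using (le_abs_self _).trans (abs_le_lpNorm_top f x)⟩
  obtain norm_zero | norm_pos := (lpNorm_nonneg p f).eq_or_lt
  · obtain ⟨M, -, hM⟩ := exists_le_lpNorm (F := F) p hp
    refine ⟨fun _ => 0, ⟨fun _ => le_rfl, by simp⟩, fun x => ?_⟩
    simpa [← norm_zero] using (le_abs_self _).trans (hM f x)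
  have p_ne : p ≠ 0 := (zero_lt_one.trans_le hp).ne'
  have div_nonneg (x : Plane F) : 0 ≤ f x / lpNorm p f := div_nonneg (hf x) norm_pos.le
  refine ⟨fun x => (f x / lpNorm p f) ^ p.toReal, ⟨fun x => Real.rpow_nonneg (div_nonneg x) _, ?_⟩,
    fun x => ?_⟩
  · simp only [Real.div_rpow (hf _) norm_pos.le, ← sum_div]
    rw [div_le_iff₀ (Real.rpow_pos_of_pos norm_pos _)]
    have := card_sq_mul_lpNorm_rpow p_ne hp' f
    simp only [abs_of_nonneg (hf _)] at this
    simp [← this]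
  · rw [ENNReal.toReal_inv, Real.rpow_rpow_inv (div_nonneg x) (ENNReal.toReal_pos p_ne hp').ne',
      mul_div_cancel₀ _ norm_pos.ne']

lemma lpNorm_ind (hp : p ≠ 0) {E : Set (Plane F)} (hE : E.Nonempty) :
    lpNorm p (ind E) = ((E.ncard : ℝ) / (Fintype.card F : ℝ) ^ 2) ^ (p⁻¹).toReal := by
  classical
  obtain rfl | hp' := eq_or_ne p ∞
  · obtain ⟨x, hx⟩ := hE
    rw [ENNReal.inv_top, ENNReal.toReal_zero, Real.rpow_zero]
    refine le_antisymm ?_ (by simpa [ind, hx] using abs_le_lpNorm_top (ind E) x)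
    rw [lpNorm, if_pos rfl]
    refine ciSup_le fun y => ?_
    rw [abs_of_nonneg (ind_nonneg E y)]
    exact Set.indicator_le_self' (fun _ _ => zero_le_one) y
  · have sum_eq : ∑ x, |ind E x| ^ p.toReal = E.ncard := by
      have rpow_eq (x : Plane F) : |ind E x| ^ p.toReal = if x ∈ E then 1 else 0 := by
        by_cases hx : x ∈ E <;> simp [ind, hx, Real.zero_rpow (ENNReal.toReal_pos hp hp').ne']
      simp [rpow_eq, ← Set.ncard_coe_finset]
    rw [lpNorm, if_neg hp', sum_eq, ENNReal.toReal_inv, one_div, div_eq_inv_mul]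

lemma lpNorm_ind_singleton (hp : p ≠ 0) (x : Plane F) :
    lpNorm p (ind {x}) = (Fintype.card F : ℝ) ^ (-(2 * (p⁻¹).toReal)) := by
  rw [lpNorm_ind hp (Set.singleton_nonempty x), Set.ncard_singleton, Nat.cast_one, one_div,
    ← Real.rpow_two, ← Real.rpow_neg cast_card_pos.le, ← Real.rpow_mul cast_card_pos.le, neg_mul]

lemma toReal_inv_le_one (hp : 1 ≤ p) : (p⁻¹).toReal ≤ 1 :=
  ENNReal.toReal_le_of_le_ofReal zero_le_one (by simpa using hp)

lemma lpNorm_ind_circle_le (h2 : (2 : F) ≠ 0) (hp : 1 ≤ p) (t : F) :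
    lpNorm p (ind (circle t)) ≤ 2 * (Fintype.card F : ℝ) ^ (-(p⁻¹).toReal) := by
  have q_pos := cast_card_pos (F := F)
  have ncard_le : ((circle t).ncard : ℝ) ≤ 2 * Fintype.card F := by
    exact_mod_cast ncard_circle_le t
  calc lpNorm p (ind (circle t))
      = ((circle t).ncard / (Fintype.card F : ℝ) ^ 2) ^ (p⁻¹).toReal :=
        lpNorm_ind (zero_lt_one.trans_le hp).ne' (circle_nonempty h2 t)
    _ ≤ (2 * (Fintype.card F : ℝ)⁻¹) ^ (p⁻¹).toReal := by
        gcongr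
        rw [div_le_iff₀ (by positivity)]
        exact ncard_le.trans_eq (by field_simp)
    _ = 2 ^ (p⁻¹).toReal * (Fintype.card F : ℝ) ^ (-(p⁻¹).toReal) := by
        rw [Real.mul_rpow two_pos.le (by positivity), Real.inv_rpow q_pos.le,
          Real.rpow_neg q_pos.le]
    _ ≤ 2 * (Fintype.card F : ℝ) ^ (-(p⁻¹).toReal) := by
        gcongr
        simpa using Real.rpow_le_rpow_of_exponent_le one_le_two (toReal_inv_le_one hp)

end Norm

section Exponents

variable {p₁ p₂ p₃ : ℝ≥0∞}

lemma ExponentCondition.one_le (h : ExponentCondition p₁ p₂ p₃) : 1 ≤ p₁ ∧ 1 ≤ p₂ ∧ 1 ≤ p₃ := by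
  have one_le {p : ℝ≥0∞} (hp : 2 / p ≤ 2) : 1 ≤ p := by
    rw [← ENNReal.inv_le_one]
    refine (ENNReal.mul_le_mul_iff_right two_ne_zero ENNReal.ofNat_ne_top).1 ?_
    rwa [mul_one, ← div_eq_mul_inv]
  exact ⟨one_le ((le_add_right le_self_add).trans h.1),
    one_le ((le_add_right le_add_self).trans h.2.1), one_le (le_add_self.trans h.2.2)⟩

lemma two_div_add_le_two_iff (h₁ : 1 ≤ p₁) (h₂ : 1 ≤ p₂) (h₃ : 1 ≤ p₃) :
    2 / p₁ + 1 / p₂ + 1 / p₃ ≤ 2 ↔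
      2 * (p₁⁻¹).toReal + (p₂⁻¹).toReal + (p₃⁻¹).toReal ≤ 2 := by
  have ne_top {p : ℝ≥0∞} (hp : 1 ≤ p) : p⁻¹ ≠ ∞ :=
    ENNReal.inv_ne_top.2 (zero_lt_one.trans_le hp).ne'
  lift p₁⁻¹ to NNReal using ne_top h₁ with u₁ hu₁
  lift p₂⁻¹ to NNReal using ne_top h₂ with u₂ hu₂
  lift p₃⁻¹ to NNReal using ne_top h₃ with u₃ hu₃
  simp only [div_eq_mul_inv, one_mul, ← hu₁, ← hu₂, ← hu₃, ENNReal.coe_toReal]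
  norm_cast

lemma exponentCondition_iff (h₁ : 1 ≤ p₁) (h₂ : 1 ≤ p₂) (h₃ : 1 ≤ p₃) :
    ExponentCondition p₁ p₂ p₃ ↔
      2 * (p₁⁻¹).toReal + (p₂⁻¹).toReal + (p₃⁻¹).toReal ≤ 2 ∧
      (p₁⁻¹).toReal + 2 * (p₂⁻¹).toReal + (p₃⁻¹).toReal ≤ 2 ∧
      (p₁⁻¹).toReal + (p₂⁻¹).toReal + 2 * (p₃⁻¹).toReal ≤ 2 := by
  rw [ExponentCondition, two_div_add_le_two_iff h₁ h₂ h₃, add_comm (1 / p₁),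
    two_div_add_le_two_iff h₂ h₁ h₃, add_comm (1 / p₁ + 1 / p₂), ← add_assoc,
    two_div_add_le_two_iff h₃ h₁ h₂]
  refine and_congr Iff.rfl (and_congr ?_ ?_) <;> constructor <;> intro h <;> linarith

lemma exponentCondition_two : ExponentCondition 2 2 2 := by
  rw [exponentCondition_iff one_le_two one_le_two one_le_two, ENNReal.toReal_inv,
    ENNReal.toReal_ofNat]
  norm_num

end Exponents

section BestConst

open Finset

variable {F : Type} [Field F] [Fintype F] {t : F} {p₁ p₂ p₃ : ℝ≥0∞}

lemma triangleSum_circleGraph_le [DecidableEq F] (h2 : (2 : F) ≠ 0) (ht : t ≠ 0)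
    (hp : ExponentCondition p₁ p₂ p₃) {f₁ f₂ f₃ : Plane F → ℝ} (n₁ : ∀ x, 0 ≤ f₁ x)
    (n₂ : ∀ x, 0 ≤ f₂ x) (n₃ : ∀ x, 0 ≤ f₃ x) :
    triangleSum (circleGraph ht) f₁ f₂ f₃ ≤
      lpNorm p₁ f₁ * lpNorm p₂ f₂ * lpNorm p₃ f₃ * (64 * (Fintype.card F : ℝ) ^ 3) := by
  obtain ⟨h₁, h₂, h₃⟩ := hp.one_le
  obtain ⟨e₁, e₂, e₃⟩ := (exponentCondition_iff h₁ h₂ h₃).1 hp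
  obtain ⟨g₁, hg₁, f₁_le⟩ := exists_isSubdensity h₁ n₁
  obtain ⟨g₂, hg₂, f₂_le⟩ := exists_isSubdensity h₂ n₂
  obtain ⟨g₃, hg₃, f₃_le⟩ := exists_isSubdensity h₃ n₃
  have card_plane : Fintype.card (Plane F) ≤ (2 * Fintype.card F) ^ 2 := by
    simpa using Nat.pow_le_pow_left (Nat.le_mul_of_pos_left (Fintype.card F) two_pos) 2
  have densities := triangleSum_rpow_le (codegreeLE_two_circleGraph h2 ht)
    (fun a => (degree_circleGraph ht a).trans_le (ncard_circle_le t)) card_plane hg₁ hg₂ hg₃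
    ENNReal.toReal_nonneg ENNReal.toReal_nonneg ENNReal.toReal_nonneg e₁ e₂ e₃
  have N₁ := lpNorm_nonneg p₁ f₁
  have N₂ := lpNorm_nonneg p₂ f₂
  have N₃ := lpNorm_nonneg p₃ f₃
  calc triangleSum (circleGraph ht) f₁ f₂ f₃
      ≤ ∑ x ∈ triangles (circleGraph ht), (lpNorm p₁ f₁ * g₁ x.1 ^ (p₁⁻¹).toReal) *
          (lpNorm p₂ f₂ * g₂ x.2.1 ^ (p₂⁻¹).toReal) *
            (lpNorm p₃ f₃ * g₃ x.2.2 ^ (p₃⁻¹).toReal) := by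
        refine sum_le_sum fun x _ => ?_
        have := n₁ x.1
        have := n₂ x.2.1
        have := n₃ x.2.2
        have := hg₁.1 x.1
        have := hg₂.1 x.2.1
        gcongr <;> apply_assumption
    _ = lpNorm p₁ f₁ * lpNorm p₂ f₂ * lpNorm p₃ f₃ * triangleSum (circleGraph ht)
          (fun a => g₁ a ^ (p₁⁻¹).toReal) (fun a => g₂ a ^ (p₂⁻¹).toReal)
          (fun a => g₃ a ^ (p₃⁻¹).toReal) := by
        rw [triangleSum, mul_sum]
        exact sum_congr rfl fun x _ => by ring
    _ ≤ _ := by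
        gcongr
        exact densities.trans_eq (by push_cast; ring)

lemma form_le (h2 : (2 : F) ≠ 0) (ht : t ≠ 0) (hp : ExponentCondition p₁ p₂ p₃)
    {f₁ f₂ f₃ : Plane F → ℝ} (n₁ : ∀ x, 0 ≤ f₁ x) (n₂ : ∀ x, 0 ≤ f₂ x) (n₃ : ∀ x, 0 ≤ f₃ x) :
    form t f₁ f₂ f₃ ≤ 192 * (lpNorm p₁ f₁ * lpNorm p₂ f₂ * lpNorm p₃ f₃) := by
  classical
  have triangles_le := triangleSum_circleGraph_le h2 ht hp n₁ n₂ n₃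
  set N := lpNorm p₁ f₁ * lpNorm p₂ f₂ * lpNorm p₃ f₃
  have N_nonneg : 0 ≤ N :=
    mul_nonneg (mul_nonneg (lpNorm_nonneg _ _) (lpNorm_nonneg _ _)) (lpNorm_nonneg _ _)
  have ncard_pos : (0 : ℝ) < (circle t).ncard := by exact_mod_cast ncard_circle_pos h2 t
  have card_le : (Fintype.card F : ℝ) ≤ 3 * (circle t).ncard := by
    exact_mod_cast card_le_three_mul_ncard_circle h2 ht
  rw [form_eq_triangleSum ht, one_div_mul_eq_div, div_le_iff₀ (by positivity)]
  calc triangleSum (circleGraph ht) f₁ f₂ f₃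
      ≤ N * (64 * (Fintype.card F : ℝ) ^ 2 * Fintype.card F) :=
        triangles_le.trans_eq (by ring)
    _ ≤ N * (64 * (Fintype.card F : ℝ) ^ 2 * (3 * (circle t).ncard)) := by gcongr
    _ = 192 * N * ((Fintype.card F : ℝ) ^ 2 * (circle t).ncard) := by ring

theorem bestConst_le (h2 : (2 : F) ≠ 0) (ht : t ≠ 0) (hp : ExponentCondition p₁ p₂ p₃) :
    bestConst t p₁ p₂ p₃ ≤ 192 :=
  csInf_le ⟨0, fun _ hC => hC.1.le⟩
    ⟨by norm_num, fun _ _ _ n₁ n₂ n₃ => form_le h2 ht hp n₁ n₂ n₃⟩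

lemma bestConst_nonneg (t : F) (p₁ p₂ p₃ : ℝ≥0∞) : 0 ≤ bestConst t p₁ p₂ p₃ :=
  Real.sInf_nonneg fun _ hC => hC.1.le

lemma bestConst_swap (ht : t ≠ 0) (p₁ p₂ p₃ : ℝ≥0∞) :
    bestConst t p₂ p₁ p₃ = bestConst t p₁ p₂ p₃ := by
  unfold bestConst
  congr 1
  ext C
  refine and_congr_right fun _ => ⟨fun h f₁ f₂ f₃ n₁ n₂ n₃ => ?_, fun h f₂ f₁ f₃ n₂ n₁ n₃ => ?_⟩
  · rw [← form_swap ht, mul_comm (lpNorm p₁ f₁)]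
    exact h f₂ f₁ f₃ n₂ n₁ n₃
  · rw [form_swap ht, mul_comm (lpNorm p₂ f₂)]
    exact h f₁ f₂ f₃ n₁ n₂ n₃

lemma bestConst_rotate (ht : t ≠ 0) (p₁ p₂ p₃ : ℝ≥0∞) :
    bestConst t p₂ p₃ p₁ = bestConst t p₁ p₂ p₃ := by
  unfold bestConst
  congr 1
  ext C
  refine and_congr_right fun _ => ⟨fun h f₁ f₂ f₃ n₁ n₂ n₃ => ?_, fun h f₂ f₃ f₁ n₂ n₃ n₁ => ?_⟩
  · rw [← form_rotate ht, mul_assoc (lpNorm p₁ f₁), mul_comm (lpNorm p₁ f₁)]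
    exact h f₂ f₃ f₁ n₂ n₃ n₁
  · rw [form_rotate ht, mul_comm (_ * lpNorm p₃ f₃), ← mul_assoc (lpNorm p₁ f₁)]
    exact h f₁ f₂ f₃ n₁ n₂ n₃

lemma ncard_circle_le_triangleSum [DecidableEq F] (h2 : (2 : F) ≠ 0) (h3 : IsSquare (3 : F))
    (ht : t ≠ 0) :
    ((circle t).ncard : ℝ) ≤
      triangleSum (circleGraph ht) (ind {0}) (ind (circle t)) (ind (circle t)) := by
  obtain ⟨R, hR⟩ := exists_mem_circle_sub_mem_circle (t := t) h2 h3
  set T : Finset (Plane F × Plane F × Plane F) := {x : Plane F | x ∈ circle t}.toFinset.image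
    fun x => (0, x, R x)
  have mem_T {y : Plane F × Plane F × Plane F} (hy : y ∈ T) :
      ∃ x ∈ circle t, (0, x, R x) = y := by simpa [T] using hy
  have card_T : #T = (circle t).ncard := by
    rw [card_image_of_injective _ fun x y h => congrArg (fun z => z.2.1) h, ncard_circle]
    congr 1
    ext
    simp
  have T_subset : T ⊆ triangles (circleGraph ht) := fun y hy => by
    obtain ⟨x, hx, rfl⟩ := mem_T hy
    simpa [mem_triangles, circleGraph_adj] using ⟨neg_mem_circle hx, (hR x hx).2, (hR x hx).1⟩
  calc ((circle t).ncard : ℝ) = ∑ _y ∈ T, (1 : ℝ) := by simp [card_T]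
    _ = ∑ y ∈ T, ind {0} y.1 * ind (circle t) y.2.1 * ind (circle t) y.2.2 :=
        sum_congr rfl fun y hy => by
          obtain ⟨x, hx, rfl⟩ := mem_T hy
          simp [ind, hx, (hR x hx).1]
    _ ≤ triangleSum (circleGraph ht) (ind {0}) (ind (circle t)) (ind (circle t)) :=
        sum_le_sum_of_subset_of_nonneg T_subset fun y _ _ =>
          mul_nonneg (mul_nonneg (ind_nonneg _ _) (ind_nonneg _ _)) (ind_nonneg _ _)

lemma le_form_ind (h2 : (2 : F) ≠ 0) (h3 : IsSquare (3 : F)) (ht : t ≠ 0) :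
    ((Fintype.card F : ℝ) ^ 2)⁻¹ ≤ form t (ind {0}) (ind (circle t)) (ind (circle t)) := by
  classical
  have ncard_pos : (0 : ℝ) < (circle t).ncard := by exact_mod_cast ncard_circle_pos h2 t
  rw [form_eq_triangleSum ht, one_div_mul_eq_div, le_div_iff₀ (by positivity),
    inv_mul_cancel_left₀ (by positivity)]
  exact ncard_circle_le_triangleSum h2 h3 ht

theorem rpow_card_le_bestConst (h2 : (2 : F) ≠ 0) (h3 : IsSquare (3 : F)) (ht : t ≠ 0)
    (h₁ : 1 ≤ p₁) (h₂ : 1 ≤ p₂) (h₃ : 1 ≤ p₃) :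
    (Fintype.card F : ℝ) ^ (2 * (p₁⁻¹).toReal + (p₂⁻¹).toReal + (p₃⁻¹).toReal - 2) ≤
      4 * bestConst t p₁ p₂ p₃ := by
  set q : ℝ := (Fintype.card F : ℝ)
  have q_pos : 0 < q := cast_card_pos
  set u₁ := (p₁⁻¹).toReal
  set u₂ := (p₂⁻¹).toReal
  set u₃ := (p₃⁻¹).toReal
  set C := bestConst t p₁ p₂ p₃
  have C_nonneg : 0 ≤ C := bestConst_nonneg t p₁ p₂ p₃
  have test : (q ^ 2)⁻¹ ≤ 4 * C * q ^ (-(2 * u₁ + u₂ + u₃)) :=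
    calc (q ^ 2)⁻¹ ≤ form t (ind {0}) (ind (circle t)) (ind (circle t)) := le_form_ind h2 h3 ht
      _ ≤ C * (lpNorm p₁ (ind {0}) * lpNorm p₂ (ind (circle t)) * lpNorm p₃ (ind (circle t))) :=
          form_le_bestConst t p₁ p₂ p₃ h₁ h₂ h₃ _ _ _ (ind_nonneg _) (ind_nonneg _) (ind_nonneg _)
      _ ≤ C * (q ^ (-(2 * u₁)) * (2 * q ^ (-u₂)) * (2 * q ^ (-u₃))) := by
          rw [lpNorm_ind_singleton (zero_lt_one.trans_le h₁).ne']
          have := lpNorm_nonneg p₃ (ind (circle t))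
          gcongr
          exacts [lpNorm_ind_circle_le h2 h₂ t, lpNorm_ind_circle_le h2 h₃ t]
      _ = 4 * C * q ^ (-(2 * u₁ + u₂ + u₃)) := by
          rw [neg_add, neg_add, Real.rpow_add q_pos, Real.rpow_add q_pos]
          ring
  calc q ^ (2 * u₁ + u₂ + u₃ - 2) = q ^ (2 * u₁ + u₂ + u₃) * (q ^ 2)⁻¹ := by
        rw [Real.rpow_sub q_pos, Real.rpow_two, div_eq_mul_inv]
    _ ≤ q ^ (2 * u₁ + u₂ + u₃) * (4 * C * q ^ (-(2 * u₁ + u₂ + u₃))) := by gcongr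
    _ = 4 * C := by
        rw [mul_left_comm, ← Real.rpow_add q_pos, add_neg_cancel, Real.rpow_zero, mul_one]

end BestConst

section Family

variable {𝒬 : Set Datum} {p₁ p₂ p₃ : ℝ≥0∞}

lemma LesssimOne.swap (h : LesssimOne 𝒬 p₁ p₂ p₃) : LesssimOne 𝒬 p₂ p₁ p₃ :=
  h.imp fun _ hC => ⟨hC.1, fun D hD => (bestConst_swap D.t_ne_zero p₁ p₂ p₃).trans_le (hC.2 D hD)⟩

lemma LesssimOne.rotate (h : LesssimOne 𝒬 p₁ p₂ p₃) : LesssimOne 𝒬 p₂ p₃ p₁ :=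
  h.imp fun _ hC =>
    ⟨hC.1, fun D hD => (bestConst_rotate D.t_ne_zero p₁ p₂ p₃).trans_le (hC.2 D hD)⟩

lemma Unbounded.nonpos_of_rpow_le (h𝒬 : Unbounded 𝒬) {e C : ℝ}
    (h : ∀ D ∈ 𝒬, (D.q : ℝ) ^ e ≤ C) : e ≤ 0 := by
  by_contra! he
  obtain ⟨N, hN⟩ := Filter.eventually_atTop.1
    (((tendsto_rpow_atTop he).comp tendsto_natCast_atTop_atTop).eventually_gt_atTop C)
  obtain ⟨D, hD, hq⟩ := h𝒬 N
  exact (hN D.q hq).not_ge (h D hD)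

lemma LesssimOne.two_mul_add_le_two (h : LesssimOne 𝒬 p₁ p₂ p₃) (h𝒬 : Unbounded 𝒬)
    (h₁ : 1 ≤ p₁) (h₂ : 1 ≤ p₂) (h₃ : 1 ≤ p₃) :
    2 * (p₁⁻¹).toReal + (p₂⁻¹).toReal + (p₃⁻¹).toReal ≤ 2 := by
  obtain ⟨C, -, hC⟩ := h
  refine sub_nonpos.1 (h𝒬.nonpos_of_rpow_le (C := 4 * C) fun D hD => ?_)
  refine (rpow_card_le_bestConst D.two_ne_zero D.isSquare_three D.t_ne_zero h₁ h₂ h₃).trans ?_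
  exact mul_le_mul_of_nonneg_left (hC D hD) zero_le_four

theorem LesssimOne.exponentCondition (h : LesssimOne 𝒬 p₁ p₂ p₃) (h𝒬 : Unbounded 𝒬)
    (h₁ : 1 ≤ p₁) (h₂ : 1 ≤ p₂) (h₃ : 1 ≤ p₃) : ExponentCondition p₁ p₂ p₃ := by
  have e₁ := h.two_mul_add_le_two h𝒬 h₁ h₂ h₃
  have e₂ := h.swap.two_mul_add_le_two h𝒬 h₂ h₁ h₃
  have e₃ := h.rotate.rotate.two_mul_add_le_two h𝒬 h₃ h₁ h₂
  exact (exponentCondition_iff h₁ h₂ h₃).2 ⟨e₁, by linarith, by linarith⟩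

lemma LesssimOne.restrictedStrongType (h : LesssimOne 𝒬 p₁ p₂ p₃) (h₁ : 1 ≤ p₁) (h₂ : 1 ≤ p₂)
    (h₃ : 1 ≤ p₃) : RestrictedStrongType 𝒬 p₁ p₂ p₃ :=
  h.imp fun _ hC => ⟨hC.1, fun D hD _ _ _ =>
    (form_le_bestConst D.t p₁ p₂ p₃ h₁ h₂ h₃ _ _ _ (ind_nonneg _) (ind_nonneg _)
      (ind_nonneg _)).trans <| mul_le_mul_of_nonneg_right (hC.2 D hD) <|
        mul_nonneg (mul_nonneg (lpNorm_nonneg _ _) (lpNorm_nonneg _ _)) (lpNorm_nonneg _ _)⟩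

end Family

end KThree

theorem theorem4p9_general {p₁ p₂ p₃ : ENNReal} :
    (1 ≤ p₁ → 1 ≤ p₂ → 1 ≤ p₃ → ∀ 𝒬 : Set KThree.Datum, KThree.Unbounded 𝒬 →
      KThree.LesssimOne 𝒬 p₁ p₂ p₃ → KThree.ExponentCondition p₁ p₂ p₃) ∧
    (KThree.ExponentCondition p₁ p₂ p₃ → ∀ (F : Type) [Field F] [Fintype F] (t : F),
      (2 : F) ≠ 0 → t ≠ 0 → KThree.bestConst t p₁ p₂ p₃ ≤ 192) :=
  ⟨fun h₁ h₂ h₃ _ h𝒬 h => h.exponentCondition h𝒬 h₁ h₂ h₃,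
    fun hp _ _ _ _ h2 ht => KThree.bestConst_le h2 ht hp⟩

theorem theorem4p9 :
    (∀ p₁ p₂ p₃ : ENNReal, 1 ≤ p₁ → 1 ≤ p₂ → 1 ≤ p₃ →
      (∀ 𝒬 : Set KThree.Datum, KThree.Unbounded 𝒬 →
        KThree.LesssimOne 𝒬 p₁ p₂ p₃ → KThree.ExponentCondition p₁ p₂ p₃) ∧
      (KThree.ExponentCondition p₁ p₂ p₃ → (p₁, p₂, p₃) ≠ (2, 2, 2) →
        KThree.LesssimOne Set.univ p₁ p₂ p₃)) ∧
    KThree.RestrictedStrongType Set.univ 2 2 2 := by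
  have lesssimOne {p₁ p₂ p₃ : ENNReal} (hp : KThree.ExponentCondition p₁ p₂ p₃) :
      KThree.LesssimOne Set.univ p₁ p₂ p₃ :=
    ⟨192, by norm_num, fun D _ => theorem4p9_general.2 hp D.F D.t D.two_ne_zero D.t_ne_zero⟩
  exact ⟨fun _ _ _ h₁ h₂ h₃ => ⟨theorem4p9_general.1 h₁ h₂ h₃, fun hp _ => lesssimOne hp⟩,
    (lesssimOne KThree.exponentCondition_two).restrictedStrongType one_le_two one_le_two one_le_two⟩
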